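/- Let $m\ge 1$ be an integer, let $b_0,b_1,\dots,b_m$ be integers with $|b_0|=|b_m|=1$ and $\gcd(b_i,m)=1$ for all $0<i<m$, and let $$G_m(x)=b_0+b_1x+b_2\frac{x^2}{2!}+\cdots+b_m\frac{x^m}{m!}\in\mathbb{Q}[x]$$ be the corresponding Schur polynomial of degree $m$. Let $p$ be a prime number dividing $m$, and let $\nu_p$ denote the $p$-adic valuation on $\mathbb{Q}$. Let $f(x)\in\mathbb{Q}[x]$ be a polynomial of degree $d$ with leading coefficient $a_d$ such that $\nu_p(a_d)=0$ and $f(x)\equiv a_dx^d \pmod p$, i.e. every coefficient $a_i$ of $f$ with $i<d$ satisfies $a_i=0$ or $\nu_p(a_i)\ge 1$. If $d$ is coprime to $m!$, then $f$ is dynamically irreducible at $G_m$, that is, $G_m\circ f^n$ is irreducible over $\mathbb{Q}$ for all $n\ge 0$, where $f^n$ denotes the $n$-th iterate of $f$ under composition and $f^0(x)=x$. -/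

import Mathlib

open Polynomial

/-- The polynomial `b₀ + b₁ x + b₂ x² / 2! + ⋯ + b_m x^m / m!` over `ℚ`. It is a Schur polynomial
of degree `m` when moreover `|b₀| = |b_m| = 1` (see `IsSchurPolynomial`). -/
noncomputable def schurPolynomial (m : ℕ) (b : ℕ → ℤ) : ℚ[X] :=
  ∑ i ∈ Finset.range (m + 1), C ((b i : ℚ) / (i.factorial : ℚ)) * X ^ i

/-- `G` is the Schur polynomial of degree `m` with integer data `b₀, …, b_m`, where
`|b₀| = |b_m| = 1` (the values `b i` for `i > m` play no role). -/
def IsSchurPolynomial (m : ℕ) (b : ℕ → ℤ) (G : ℚ[X]) : Prop :=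
  |b 0| = 1 ∧ |b m| = 1 ∧ G = schurPolynomial m b

/-- Congruence of rational polynomials modulo a prime `p`: every coefficient of `f - g` lies in
`p ℤ_(p)`, that is, it is zero or has `p`-adic valuation at least one. (`padicValRat p 0 = 0`, so
the zero coefficient has to be listed separately.) -/
def PolyCongrMod (p : ℕ) (f g : ℚ[X]) : Prop :=
  ∀ i : ℕ, (f - g).coeff i = 0 ∨ 1 ≤ padicValRat p ((f - g).coeff i)

/-- The `n`-th iterate `fⁿ = f ∘ ⋯ ∘ f` of a polynomial, with `f⁰ = x`. -/
noncomputable def polyIterate (f : ℚ[X]) (n : ℕ) : ℚ[X] :=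
  f.comp^[n] X

/-- `f` is dynamically irreducible at `g`: all `g ∘ fⁿ`, `n ≥ 0`, are irreducible over `ℚ`. -/
def DynamicallyIrreducibleAt (f g : ℚ[X]) : Prop :=
  ∀ n : ℕ, Irreducible (g.comp (polyIterate f n))

/-! Let `θ` be a root of an irreducible factor `g` of `G ∘ f^k`, and `K = ℚ(θ)`. Every ramification
index `e` of `K` over suitable primes is shown to be divisible by the right numbers; since `[K : ℚ]
= ∑ e f`, this gives `m * d ^ k ∣ deg g`, so `g` is the whole polynomial up to a unit. For a prime
`q` with `q ^ v ∣ m`, Legendre's formula turns the valuations of the terms of `G(α) = 0`, where `α =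
f^k(θ)`, into base-`q` digit sums. No term may strictly dominate, which forces `α` to have valuation
`a = e (q ^ n - 1) / (q ^ n (q - 1))` with `n ≥ v`; hence `q ^ v ∣ e`. At `q = p` one has `0 < a <
e`, so `f ≡ A x ^ d` makes each preimage under `f` divide the valuation by `d`. Thus `d ^ k ∣ a`,
and `d ^ k ∣ e` because `d` is prime to `p ^ n - 1`. -/

/-! ### Digit sums in base `p` -/

theorem sum_digits_mul_add {p : ℕ} (hp : 1 < p) (x y : ℕ) (hx : x < p) :
    (p.digits (p * y + x)).sum = (p.digits y).sum + x := by
  by_cases h : x ≠ 0 ∨ y ≠ 0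
  · rw [add_comm, Nat.digits_add p hp x y hx h, List.sum_cons, add_comm]
  · obtain ⟨rfl, rfl⟩ : x = 0 ∧ y = 0 := by tauto
    simp

theorem sum_digits_pow_mul_add {p : ℕ} (hp : 1 < p) (r q l : ℕ) (hl : l < p ^ r) :
    (p.digits (p ^ r * q + l)).sum = (p.digits q).sum + (p.digits l).sum := by
  induction r generalizing l with
  | zero =>
    obtain rfl : l = 0 := by simpa using hl
    simp
  | succ r ih =>
    have hmod : l % p < p := Nat.mod_lt _ (by omega)
    have hdiv : l / p < p ^ r := Nat.div_lt_of_lt_mul (by rwa [← pow_succ'])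
    have hl' := Nat.div_add_mod l p
    have h1 : p ^ (r + 1) * q + l = p * (p ^ r * q + l / p) + l % p := by
      conv_lhs => rw [← hl']
      ring
    have h2 := sum_digits_mul_add hp (l % p) (l / p) hmod
    rw [hl'] at h2
    rw [h1, sum_digits_mul_add hp _ _ hmod, ih _ hdiv, h2, add_assoc]

theorem sum_digits_succ_le {p : ℕ} (hp : 1 < p) (q : ℕ) :
    (p.digits (q + 1)).sum ≤ (p.digits q).sum + 1 := by
  induction q using Nat.strong_induction_on with
  | _ q ih =>
    have hmod : q % p < p := Nat.mod_lt _ (by omega)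
    have hq := Nat.div_add_mod q p
    have h2 := sum_digits_mul_add hp (q % p) (q / p) hmod
    rw [hq] at h2
    by_cases h : q % p + 1 < p
    · have h1 : q + 1 = p * (q / p) + (q % p + 1) := by omega
      rw [h1, sum_digits_mul_add hp _ _ h, h2, add_assoc]
    · have hqp : q ≠ 0 := by
        rintro rfl
        simp at h
        omega
      have h1 : q + 1 = p * (q / p + 1) + 0 := by rw [mul_add]; omega
      have := ih (q / p) (Nat.div_lt_self (by omega) hp)
      rw [h1, sum_digits_mul_add hp _ _ (by omega), h2]
      omega

/-- Each digit of `l` has place value at most `p ^ r`. -/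
theorem le_pow_mul_sum_digits {p : ℕ} (hp : 1 < p) (r l : ℕ) (hl : l < p ^ (r + 1)) :
    l ≤ p ^ r * (p.digits l).sum := by
  induction r generalizing l with
  | zero =>
    have := sum_digits_mul_add hp l 0 (by simpa using hl)
    simp at this
    simp [this]
  | succ r ih =>
    have hmod : l % p < p := Nat.mod_lt _ (by omega)
    have hdiv : l / p < p ^ (r + 1) := Nat.div_lt_of_lt_mul (by rwa [← pow_succ'])
    have hl' := Nat.div_add_mod l p
    have h2 := sum_digits_mul_add hp (l % p) (l / p) hmod
    rw [hl'] at h2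
    rw [h2]
    have h3 := Nat.mul_le_mul_left p (ih _ hdiv)
    have h4 : l % p ≤ p ^ (r + 1) * (l % p) := Nat.le_mul_of_pos_left _ (by positivity)
    calc l = p * (l / p) + l % p := hl'.symm
      _ ≤ p * (p ^ r * (p.digits (l / p)).sum) + p ^ (r + 1) * (l % p) := by omega
      _ = _ := by ring

/-- The function `i ↦ e * s(i) - c * i`, with `s` the digit sum in base `p`, has a unique
minimum on `[0, m]`, unless `c * p ^ n = e` for some `n` with `p ^ n ≤ m` that is at least the
exponent of `p` in `m`. -/
theorem exists_unique_min_or_exists_pow {p : ℕ} (hp : 1 < p) {e : ℤ} (he : 0 < e) (c : ℤ)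
    {m v : ℕ} (hv : p ^ v ∣ m) :
    (∃ j ≤ m, ∀ i ≤ m, i ≠ j →
      e * (p.digits j).sum - c * j < e * (p.digits i).sum - c * i) ∨
    ∃ n, v ≤ n ∧ p ^ n ≤ m ∧ c * (p : ℤ) ^ n = e := by
  classical
  by_cases hn : ∃ n, v ≤ n ∧ p ^ n ≤ m ∧ c * (p : ℤ) ^ n = e
  · exact Or.inr hn
  left
  -- The block size `p ^ r` is the first scale at which `c * p ^ r` exceeds `e`, or which exceeds
  -- `m`. With `i = p ^ r * q + l`, the function splits into a part in `q` and a part in `l`.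
  have hex : ∃ r, e < c * (p : ℤ) ^ r ∨ m < p ^ r :=
    ⟨m, Or.inr (Nat.lt_pow_self hp)⟩
  obtain ⟨r, hr, hrmin⟩ : ∃ r, (e < c * (p : ℤ) ^ r ∨ m < p ^ r) ∧
      ∀ k < r, ¬ (e < c * (p : ℤ) ^ k ∨ m < p ^ k) :=
    ⟨Nat.find hex, Nat.find_spec hex, fun k hk => Nat.find_min hex hk⟩
  have hpr : 0 < p ^ r := by positivity
  have nonneg : ∀ l < p ^ r, 0 ≤ e * (p.digits l).sum - c * l := by
    intro l hl
    rcases r with _ | k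
    · obtain rfl : l = 0 := by simpa using hl
      simp
    · have h1 := hrmin k (by omega)
      push Not at h1
      have h2 : (l : ℤ) ≤ (p : ℤ) ^ k * (p.digits l).sum := by
        exact_mod_cast le_pow_mul_sum_digits hp k l hl
      rcases le_or_gt c 0 with hc | hc
      · have : 0 ≤ e * ((p.digits l).sum : ℤ) := by positivity
        have : c * (l : ℤ) ≤ 0 := mul_nonpos_of_nonpos_of_nonneg hc (by positivity)
        omega
      · have h3 := mul_le_mul_of_nonneg_left h2 hc.le
        have h4 := mul_le_mul_of_nonneg_right h1.1
          (by positivity : (0 : ℤ) ≤ ((p.digits l).sum : ℤ))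
        linarith
  have pos : v < r → ∀ l < p ^ r, l ≠ 0 → 0 < e * (p.digits l).sum - c * l := by
    intro hvr l hl hl0
    obtain ⟨k, rfl⟩ : ∃ k, r = k + 1 := ⟨r - 1, by omega⟩
    have h1 := hrmin k (by omega)
    push Not at h1
    have h1' : c * (p : ℤ) ^ k < e :=
      lt_of_le_of_ne h1.1 fun h => hn ⟨k, by omega, h1.2, h⟩
    have h2' := le_pow_mul_sum_digits hp k l hl
    have h2 : (l : ℤ) ≤ (p : ℤ) ^ k * (p.digits l).sum := by exact_mod_cast h2'
    have h5 : 0 < (p.digits l).sum := by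
      rcases Nat.eq_zero_or_pos (p.digits l).sum with h | h
      · rw [h] at h2'
        omega
      · exact h
    rcases le_or_gt c 0 with hc | hc
    · have : 0 < e * ((p.digits l).sum : ℤ) := by positivity
      have : c * (l : ℤ) ≤ 0 := mul_nonpos_of_nonpos_of_nonneg hc (by positivity)
      omega
    · have h3 := mul_le_mul_of_nonneg_left h2 hc.le
      have h4 := mul_lt_mul_of_pos_right h1' (by exact_mod_cast h5 : (0 : ℤ) < (p.digits l).sum)
      linarith
  have split : ∀ q l, l < p ^ r →
      e * ((p.digits (p ^ r * q + l)).sum : ℤ) - c * ((p ^ r * q + l : ℕ) : ℤ) =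
        (e * (p.digits q).sum - c * (p : ℤ) ^ r * q) + (e * (p.digits l).sum - c * l) := by
    intro q l hl
    rw [sum_digits_pow_mul_add hp r q l hl]
    push_cast
    ring
  -- The part in `l` is least at `0` and the part in `q` decreases, so the minimum is at the largest
  -- multiple of `p ^ r` up to `m`.
  refine ⟨p ^ r * (m / p ^ r), Nat.mul_div_le _ _, fun i hi hij => ?_⟩
  have hl : i % p ^ r < p ^ r := Nat.mod_lt _ hpr
  have hi' := Nat.div_add_mod i (p ^ r)
  have e1 := split (i / p ^ r) (i % p ^ r) hl
  have e2 := split (m / p ^ r) 0 hpr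
  rw [hi'] at e1
  simp only [add_zero, Nat.digits_zero, List.sum_nil, Nat.cast_zero, mul_zero, sub_zero] at e2
  rw [e1, e2]
  rcases (Nat.div_le_div_right hi : i / p ^ r ≤ m / p ^ r).eq_or_lt with hq | hq
  · have hl0 : i % p ^ r ≠ 0 := by
      intro h0
      rw [h0, hq] at hi'
      exact hij hi'.symm
    -- If `r ≤ v` then `p ^ r ∣ m`, so the top block within `[0, m]` is `m` alone.
    have hvr : v < r := by
      by_contra hvr
      have : p ^ r ∣ m := (pow_dvd_pow p (by omega)).trans hv
      rw [hq, Nat.mul_div_cancel' this] at hi'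
      exact hl0 (by linarith [Nat.zero_le (i % p ^ r)])
    have := pos hvr _ hl hl0
    rw [hq]
    linarith
  · have hrm : p ^ r ≤ m := by
      by_contra h
      rw [Nat.div_eq_of_lt (not_le.mp h)] at hq
      exact Nat.not_lt_zero _ hq
    have hc : e < c * (p : ℤ) ^ r := hr.resolve_right (by omega)
    have anti : StrictAnti fun q : ℕ => e * ((p.digits q).sum : ℤ) - c * (p : ℤ) ^ r * q := by
      refine strictAnti_nat_of_succ_lt fun q => ?_
      have h1 : ((p.digits (q + 1)).sum : ℤ) ≤ (p.digits q).sum + 1 := by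
        exact_mod_cast sum_digits_succ_le hp q
      have h2 := mul_le_mul_of_nonneg_left h1 he.le
      rw [Nat.cast_add_one]
      linarith
    have h1 := anti hq
    have h2 := nonneg _ hl
    simp only at h1
    linarith

/-! ### Valuations above `p` and ramification -/

/-- The restriction to `ℚ` of the valuation `w` is the `e`-th power of the `p`-adic one. -/
def RestrictsToPadic {K : Type*} [Field K] (w : Valuation K (WithZero (Multiplicative ℤ)))
    (p : ℕ) (e : ℤ) : Prop :=
  ∀ x : ℚ, x ≠ 0 → w (x : K) = WithZero.exp (-(e * padicValRat p x))

theorem RestrictsToPadic.of_nat {K : Type*} [Field K] [CharZero K]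
    {w : Valuation K (WithZero (Multiplicative ℤ))} {p : ℕ} (hp : p.Prime) {e : ℤ}
    (hwp : w (p : K) = WithZero.exp (-e)) (hw : ∀ n : ℕ, ¬ p ∣ n → w (n : K) = 1) :
    RestrictsToPadic w p e := by
  have : Fact p.Prime := ⟨hp⟩
  have hnat : ∀ n : ℕ, n ≠ 0 → w (n : K) = WithZero.exp (-(e * padicValNat p n)) := by
    intro n hn
    obtain ⟨k, u, hu, rfl⟩ := Nat.exists_eq_pow_mul_and_not_dvd hn p hp.ne_one
    have hu0 : u ≠ 0 := by rintro rfl; simp at hu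
    rw [padicValNat.mul (pow_ne_zero _ hp.ne_zero) hu0, padicValNat.prime_pow,
      padicValNat.eq_zero_of_not_dvd hu]
    push_cast
    rw [map_mul, map_pow, hwp, hw u hu, ← WithZero.exp_nsmul]
    simp [mul_comm]
  intro x hx
  have hden : w (x.den : K) = _ := hnat _ x.den_ne_zero
  have hnum : w (x.num : K) = WithZero.exp (-(e * padicValInt p x.num)) := by
    have hn := hnat x.num.natAbs (by simpa using hx)
    rw [padicValInt, ← hn, ← Int.cast_natCast, Int.natCast_natAbs]
    rcases abs_choice x.num with h | h <;> simp [h]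
  rw [Rat.cast_def, map_div₀, hnum, hden, ← WithZero.exp_sub, padicValRat]
  congr 1
  ring

open NumberField IsDedekindDomain in
-- The degree is `∑ e f` over the primes above `p`, and the valuation of each such prime restricts
-- with exponent its ramification index `e`.
theorem dvd_finrank_of_forall_restrictsToPadic {K : Type*} [Field K] [NumberField K] {p : ℕ}
    (hp : p.Prime) (N : ℕ)
    (h : ∀ (w : Valuation K (WithZero (Multiplicative ℤ))) (e : ℕ), 0 < e →
      RestrictsToPadic w p e → N ∣ e) :
    N ∣ Module.finrank ℚ K := by
  have hpz : Prime (p : ℤ) := Nat.prime_iff_prime_int.mp hp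
  let v : HeightOneSpectrum ℤ := ⟨Ideal.span {(p : ℤ)},
    (Ideal.span_singleton_prime hpz.ne_zero).mpr hpz, by simp [hp.ne_zero]⟩
  have hvmem : ∀ n : ℕ, (n : ℤ) ∈ v.asIdeal ↔ p ∣ n := by
    intro n
    rw [Ideal.mem_span_singleton]
    exact Int.natCast_dvd_natCast
  have : v.asIdeal.IsPrime := v.isPrime
  have : Fintype (v.asIdeal.primesOver (𝓞 K)) :=
    (Algebra.QuasiFinite.finite_primesOver v.asIdeal).fintype
  have hsum := Ideal.sum_ramification_inertia_eq_finrank (S := 𝓞 K) v.asIdeal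
  rw [RingOfIntegers.rank] at hsum
  rw [← hsum]
  refine Finset.dvd_sum fun q _ => Dvd.dvd.mul_right ?_ _
  have hqp : q.1.IsPrime := q.2.1
  have hql : q.1.LiesOver v.asIdeal := q.2.2
  have hq0 : q.1 ≠ ⊥ := Ideal.ne_bot_of_liesOver_of_ne_bot v.ne_bot q.1
  let u : HeightOneSpectrum (𝓞 K) := ⟨q.1, hqp, hq0⟩
  have : u.asIdeal.LiesOver v.asIdeal := hql
  have hram : v.asIdeal.ramificationIdx' u.asIdeal = q.1.ramificationIdx ℤ :=
    Ideal.ramificationIdx'_eq_ramificationIdx _ _ v.ne_bot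
  have hval : ∀ n : ℕ, u.valuation K (n : K) = v.intValuation (n : ℤ) ^ q.1.ramificationIdx ℤ := by
    intro n
    have := HeightOneSpectrum.valuation_liesOver (K := ℚ) K v u (n : ℚ)
    rw [hram] at this
    have h2 := HeightOneSpectrum.valuation_of_algebraMap (K := ℚ) v (n : ℤ)
    simp only [map_natCast] at this h2
    rw [← this, h2]
  refine h (u.valuation K) _ ?_ (RestrictsToPadic.of_nat hp ?_ ?_)
  · rw [← hram]
    exact Nat.pos_of_ne_zero
      (Ideal.IsDedekindDomain.ramificationIdx'_ne_zero_of_liesOver _ v.ne_bot)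
  · rw [hval, HeightOneSpectrum.intValuation_singleton v hpz.ne_zero rfl, ← WithZero.exp_nsmul]
    simp
  · intro n hn
    rw [hval, HeightOneSpectrum.intValuation_eq_one_iff.mpr (by rwa [hvmem]), one_pow]

theorem WithZero.exists_eq_exp_neg {x : WithZero (Multiplicative ℤ)} (hx : x ≠ 0) :
    ∃ a : ℤ, x = WithZero.exp (-a) :=
  ⟨-WithZero.log x, by rw [neg_neg, WithZero.exp_log hx]⟩

theorem sub_one_mul_padicValNat_factorial_int {p : ℕ} (hp : p.Prime) (n : ℕ) :
    ((p : ℤ) - 1) * padicValNat p n.factorial = n - (p.digits n).sum := by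
  have : Fact p.Prime := ⟨hp⟩
  have h := sub_one_mul_padicValNat_factorial (p := p) n
  have h1 := Nat.digit_sum_le p n
  have h2 := hp.one_le
  rw [← Nat.cast_inj (R := ℤ), Nat.cast_mul, Nat.cast_sub h1, Nat.cast_sub h2] at h
  exact_mod_cast h

/-! ### Valuations of roots and of their preimages -/

/-- The valuation of a root of a Schur polynomial whose coefficients are prime to `p`. -/
theorem RestrictsToPadic.exists_valuation_root {K : Type*} [Field K] [CharZero K]
    {w : Valuation K (WithZero (Multiplicative ℤ))} {p : ℕ} {e : ℤ} (hw : RestrictsToPadic w p e)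
    (hp : p.Prime) (he : 0 < e) {m v : ℕ} (hm : 0 < m) (hv : p ^ v ∣ m) {b : ℕ → ℤ}
    (hb : ∀ i ≤ m, ¬ (p : ℤ) ∣ b i) {α : K} (hα : aeval α (schurPolynomial m b) = 0) :
    ∃ n a, v ≤ n ∧ p ^ n ≤ m ∧ w α = WithZero.exp (-a) ∧
      (p : ℤ) ^ n * ((p - 1) * a) = e * (p ^ n - 1) := by
  have : Fact p.Prime := ⟨hp⟩
  have hb0 : ∀ i ≤ m, (b i : ℚ) ≠ 0 := fun i hi h => hb i hi (by simp [Int.cast_eq_zero.mp h])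
  have hsum : ∑ i ∈ Finset.range (m + 1),
      (((b i : ℚ) / (i.factorial : ℚ) : ℚ) : K) * α ^ i = 0 := by
    rw [← hα, schurPolynomial, map_sum]
    simp
  have hα0 : α ≠ 0 := by
    rintro rfl
    rw [Finset.sum_range_succ', Finset.sum_eq_zero (by simp)] at hsum
    exact hb0 0 (by omega) (by simpa using hsum)
  obtain ⟨a, ha⟩ := WithZero.exists_eq_exp_neg ((w.ne_zero_iff).mpr hα0)
  have hterm : ∀ i ≤ m, w ((((b i : ℚ) / (i.factorial : ℚ) : ℚ) : K) * α ^ i) =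
      WithZero.exp (e * padicValNat p i.factorial - a * i) := by
    intro i hi
    have hf : (i.factorial : ℚ) ≠ 0 := by exact_mod_cast i.factorial_ne_zero
    rw [map_mul, map_pow, ha, hw _ (div_ne_zero (hb0 i hi) hf), padicValRat.div (hb0 i hi) hf,
      padicValRat.of_int, padicValRat.of_nat, padicValInt.eq_zero_of_not_dvd (hb i hi),
      ← WithZero.exp_nsmul, ← WithZero.exp_add]
    congr 1
    rw [nsmul_eq_mul]
    push_cast
    ring
  -- Multiplying the exponent in `hterm` by `p - 1` and applying Legendre's formula gives `-(e *
  -- s(i) - c * i)` with this `c`. A unique minimum is then a dominant term in a vanishing sum.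
  rcases exists_unique_min_or_exists_pow hp.one_lt he (e - (p - 1) * a) hv with
    ⟨j, hj, hmin⟩ | ⟨n, hn, hnm, hc⟩
  · exfalso
    have hmax := w.map_sum_eq_of_lt (s := Finset.range (m + 1))
      (f := fun i => (((b i : ℚ) / (i.factorial : ℚ) : ℚ) : K) * α ^ i) (j := j)
      (by simp; omega) (fun i hi => by
        simp only [Finset.mem_sdiff, Finset.mem_range, Finset.mem_singleton] at hi
        rw [hterm i (by omega), hterm j hj, WithZero.exp_lt_exp]
        have h1 := hmin i (by omega) hi.2
        have h2 := sub_one_mul_padicValNat_factorial_int hp i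
        have h3 := sub_one_mul_padicValNat_factorial_int hp j
        have h4 : (0 : ℤ) < p - 1 := by have := hp.one_lt; omega
        refine lt_of_mul_lt_mul_left ?_ h4.le
        have h5 := congrArg (e * ·) h2
        have h6 := congrArg (e * ·) h3
        linarith)
    rw [hsum, hterm j hj, map_zero] at hmax
    exact WithZero.exp_ne_zero hmax.symm
  · exact ⟨n, a, hn, hnm, ha, by linarith⟩

/-- If `f ≡ A x ^ d` modulo `p` and `f y` has valuation strictly between `0` and that of `p`,
then `y` has valuation `d` times smaller. -/
theorem RestrictsToPadic.exists_valuation_of_aeval {K : Type*} [Field K] [CharZero K]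
    {w : Valuation K (WithZero (Multiplicative ℤ))} {p : ℕ} {e : ℤ} (hw : RestrictsToPadic w p e)
    {f : ℚ[X]} (hd : 0 < f.natDegree) (hlead : padicValRat p f.leadingCoeff = 0)
    (hf : ∀ i < f.natDegree, f.coeff i = 0 ∨ 1 ≤ padicValRat p (f.coeff i))
    {y : K} {a : ℤ} (ha : 0 < a) (hae : a < e) (hy : w (aeval y f) = WithZero.exp (-a)) :
    ∃ a', w y = WithZero.exp (-a') ∧ f.natDegree * a' = a := by
  have hf0 : f.leadingCoeff ≠ 0 := by
    rw [ne_eq, leadingCoeff_eq_zero]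
    rintro rfl
    simp at hd
  have hcoeff : ∀ i < f.natDegree, w ((f.coeff i : ℚ) : K) ≤ WithZero.exp (-e) := by
    intro i hi
    by_cases h0 : f.coeff i = 0
    · simp [h0]
    · rw [hw _ h0, WithZero.exp_le_exp, neg_le_neg_iff]
      exact le_mul_of_one_le_right (by omega) ((hf i hi).resolve_left h0)
  have hexp : aeval y f = ∑ i ∈ Finset.range f.natDegree, ((f.coeff i : ℚ) : K) * y ^ i +
      ((f.leadingCoeff : ℚ) : K) * y ^ f.natDegree := by
    rw [aeval_eq_sum_range, Finset.sum_range_succ]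
    simp [Algebra.smul_def]
  set S := ∑ i ∈ Finset.range f.natDegree, ((f.coeff i : ℚ) : K) * y ^ i
  have hA : w ((f.leadingCoeff : ℚ) : K) = 1 := by
    rw [hw _ hf0, hlead]
    simp
  have hAy : w (((f.leadingCoeff : ℚ) : K) * y ^ f.natDegree) = w y ^ f.natDegree := by
    rw [map_mul, map_pow, hA, one_mul]
  rcases le_or_gt (w y) 1 with h1 | h1
  -- Lower terms have valuation at least `e > a`, so the leading term alone determines that of `f
  -- y`.
  · have hS : w S ≤ WithZero.exp (-e) := by
      refine w.map_sum_le fun i hi => ?_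
      rw [map_mul, map_pow]
      exact (mul_le_of_le_one_right' (pow_le_one' h1 i)).trans
        (hcoeff i (Finset.mem_range.mp hi))
    have h2 : w y ^ f.natDegree = WithZero.exp (-a) := by
      rw [← hAy, ← hy, ← w.map_sub_eq_of_lt_left (x := aeval y f) (y := S), hexp,
        add_sub_cancel_left]
      rw [hy]
      exact hS.trans_lt (WithZero.exp_lt_exp.mpr (by omega))
    have h3 : w y ≠ 0 := by
      intro h
      rw [h, zero_pow hd.ne'] at h2
      exact WithZero.exp_ne_zero h2.symm
    obtain ⟨a', ha'⟩ := WithZero.exists_eq_exp_neg h3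
    refine ⟨a', ha', ?_⟩
    rw [ha', ← WithZero.exp_nsmul, WithZero.exp_inj, nsmul_eq_mul] at h2
    linarith
  -- For non-integral `y` the leading term dominates, so `f y` would be non-integral too.
  · exfalso
    have hy0 : 0 < w y := zero_lt_one.trans h1
    have hS : w S < w y ^ f.natDegree := by
      refine w.map_sum_lt (pow_ne_zero _ hy0.ne') fun i hi => ?_
      have hi' := Finset.mem_range.mp hi
      rw [map_mul, map_pow]
      have h4 : w ((f.coeff i : ℚ) : K) ≤ 1 :=
        (hcoeff i hi').trans (by rw [← WithZero.exp_zero, WithZero.exp_le_exp]; omega)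
      exact (mul_le_of_le_one_left' h4).trans_lt (pow_lt_pow_right₀ h1 hi')
    rw [hexp, w.map_add_eq_of_lt_right (by rwa [hAy]), hAy] at hy
    have h5 : (1 : WithZero (Multiplicative ℤ)) < w y ^ f.natDegree :=
      one_lt_pow₀ h1 hd.ne'
    rw [hy, ← WithZero.exp_zero, WithZero.exp_lt_exp] at h5
    omega

theorem RestrictsToPadic.exists_valuation_of_aeval_polyIterate {K : Type*} [Field K] [CharZero K]
    {w : Valuation K (WithZero (Multiplicative ℤ))} {p : ℕ} {e : ℤ} (hw : RestrictsToPadic w p e)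
    {f : ℚ[X]} (hd : 0 < f.natDegree) (hlead : padicValRat p f.leadingCoeff = 0)
    (hf : ∀ i < f.natDegree, f.coeff i = 0 ∨ 1 ≤ padicValRat p (f.coeff i))
    {y : K} {a : ℤ} (ha : 0 < a) (hae : a < e) (n : ℕ)
    (hy : w (aeval y (polyIterate f n)) = WithZero.exp (-a)) :
    ∃ a', w y = WithZero.exp (-a') ∧ (f.natDegree : ℤ) ^ n * a' = a := by
  induction n generalizing a with
  | zero => exact ⟨a, by simpa [polyIterate] using hy, by simp⟩
  | succ n ih =>
    have hcomp : polyIterate f (n + 1) = f.comp (polyIterate f n) := by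
      simp only [polyIterate, Function.iterate_succ_apply']
    rw [hcomp, aeval_comp] at hy
    obtain ⟨a₁, h1, h2⟩ := hw.exists_valuation_of_aeval hd hlead hf ha hae hy
    have hd' : (1 : ℤ) ≤ f.natDegree := by exact_mod_cast hd
    have ha1 : 0 < a₁ := by
      by_contra h
      have := mul_nonpos_of_nonneg_of_nonpos (zero_le_one.trans hd') (not_lt.mp h)
      omega
    have hle : a₁ ≤ a := by
      rw [← h2]
      exact le_mul_of_one_le_left ha1.le hd'
    obtain ⟨a', h3, h4⟩ := ih ha1 (by omega) h1
    exact ⟨a', h3, by rw [← h2, ← h4]; ring⟩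

/-! ### Degrees and conclusion -/

theorem natDegree_polyIterate (f : ℚ[X]) (n : ℕ) :
    (polyIterate f n).natDegree = f.natDegree ^ n := by
  simp [polyIterate, natDegree_iterate_comp]

theorem natDegree_schurPolynomial (m : ℕ) (b : ℕ → ℤ) (hb : b m ≠ 0) :
    (schurPolynomial m b).natDegree = m := by
  rw [schurPolynomial, Finset.sum_range_succ]
  have hc : ((b m : ℚ) / (m.factorial : ℚ)) ≠ 0 :=
    div_ne_zero (by exact_mod_cast hb) (by exact_mod_cast m.factorial_ne_zero)
  have hdeg : (C ((b m : ℚ) / (m.factorial : ℚ)) * X ^ m).degree = (m : WithBot ℕ) := degree_C_mul_X_pow m hc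
  rcases Nat.eq_zero_or_pos m with rfl | hm
  · simp
  refine natDegree_eq_of_degree_eq_some ?_
  rw [degree_add_eq_right_of_degree_lt, hdeg]
  rw [hdeg]
  refine (degree_sum_le _ _).trans_lt ((Finset.sup_lt_iff (WithBot.bot_lt_coe m)).mpr ?_)
  intro i hi
  exact (degree_C_mul_X_pow_le _ _).trans_lt (WithBot.coe_lt_coe.mpr (Finset.mem_range.mp hi))

/-- A polynomial over a field is irreducible if its degree divides the degree of each of its
irreducible factors. -/
theorem Polynomial.irreducible_of_natDegree_dvd {F : Type*} [Field F] {H : F[X]}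
    (hH : 0 < H.natDegree)
    (h : ∀ g : F[X], Irreducible g → g ∣ H → H.natDegree ∣ g.natDegree) : Irreducible H := by
  have hH0 : H ≠ 0 := by rintro rfl; simp at hH
  obtain ⟨g, hg, hgH⟩ := WfDvdMonoid.exists_irreducible_factor
    (not_isUnit_of_natDegree_pos H hH) hH0
  have hle := Nat.le_of_dvd hg.natDegree_pos (h g hg hgH)
  exact (associated_of_dvd_of_natDegree_le hgH hH0 hle).irreducible hg

theorem coprime_pow_sub_one {m d p n : ℕ} (hdm : d.Coprime m.factorial) (hp : 1 < p) (hn : 0 < n)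
    (hnm : p ^ n ≤ m) : d.Coprime (p ^ n - 1) := by
  refine hdm.coprime_dvd_right (Nat.dvd_factorial ?_ (by omega))
  have := Nat.one_lt_pow hn.ne' hp
  omega

theorem theorem1p8 (m : ℕ) (hm : 1 ≤ m) (b : ℕ → ℤ) (G : ℚ[X])
    (hG : IsSchurPolynomial m b G)
    (p : ℕ) (hp : p.Prime) (hpm : p ∣ m)
    (f : ℚ[X]) (d : ℕ) (hd : f.natDegree = d)
    (hlead : padicValRat p f.leadingCoeff = 0)
    (hf : PolyCongrMod p f (C f.leadingCoeff * X ^ d))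
    (hdm : d.Coprime m.factorial)
    (hb : ∀ i : ℕ, 0 < i → i < m → Int.gcd (b i) (m : ℤ) = 1) :
    DynamicallyIrreducibleAt f G := by
  intro k
  obtain ⟨hb0, hbm, rfl⟩ := hG
  subst hd
  have hm2 : 2 ≤ m := hp.two_le.trans (Nat.le_of_dvd hm hpm)
  have hd0 : 0 < f.natDegree := by
    rcases Nat.eq_zero_or_pos f.natDegree with h | h
    · rw [h, Nat.coprime_zero_left, Nat.factorial_eq_one] at hdm
      omega
    · exact h
  have hf' : ∀ i < f.natDegree, f.coeff i = 0 ∨ 1 ≤ padicValRat p (f.coeff i) := by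
    intro i hi
    have h := hf i
    rwa [coeff_sub, coeff_C_mul_X_pow, if_neg hi.ne, sub_zero] at h
  have hunit : ∀ q : ℕ, q.Prime → q ∣ m → ∀ i ≤ m, ¬ (q : ℤ) ∣ b i := by
    intro q hq hqm i hi hdvd
    have habs : |b i| ≠ 1 := by
      intro h1
      have := Int.natCast_dvd.mp ((dvd_abs _ _).mpr hdvd)
      rw [h1] at this
      exact hq.one_lt.ne' (Nat.dvd_one.mp (by simpa using this))
    rcases Nat.eq_zero_or_pos i with rfl | hi0
    · exact habs hb0
    rcases hi.eq_or_lt with rfl | him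
    · exact habs hbm
    have := Int.dvd_coe_gcd hdvd (Int.natCast_dvd_natCast.mpr hqm)
    rw [hb i hi0 him] at this
    exact hq.one_lt.ne' (Nat.dvd_one.mp (by exact_mod_cast this))
  have hbm0 : b m ≠ 0 := by
    intro h
    simp [h] at hbm
  have hdeg : ((schurPolynomial m b).comp (polyIterate f k)).natDegree =
      m * f.natDegree ^ k := by
    rw [natDegree_comp, natDegree_schurPolynomial m b hbm0, natDegree_polyIterate]
  refine irreducible_of_natDegree_dvd (by rw [hdeg]; positivity) fun g hg hgH => ?_
  rw [hdeg]
  have : Fact (Irreducible g) := ⟨hg⟩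
  have hfin : Module.finrank ℚ (AdjoinRoot g) = g.natDegree :=
    (AdjoinRoot.powerBasis hg.ne_zero).finrank
  have : FiniteDimensional ℚ (AdjoinRoot g) := (AdjoinRoot.powerBasis hg.ne_zero).finite
  have : CharZero (AdjoinRoot g) := algebraRat.charZero _
  have : NumberField (AdjoinRoot g) := ⟨⟩
  rw [← hfin]
  have hroot : aeval (aeval (AdjoinRoot.root g) (polyIterate f k)) (schurPolynomial m b) = 0 := by
    rw [← aeval_comp]
    obtain ⟨q, hq⟩ := hgH
    rw [hq, map_mul, aeval_def, Subsingleton.elim (algebraMap ℚ _) (AdjoinRoot.of g),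
      AdjoinRoot.eval₂_root, zero_mul]
  have hcop : m.Coprime (f.natDegree ^ k) :=
    (Nat.Coprime.pow_left k (hdm.coprime_dvd_right (Nat.dvd_factorial hm le_rfl))).symm
  refine hcop.mul_dvd_of_dvd_of_dvd ?_ ?_
  · refine (Nat.dvd_iff_prime_pow_dvd_dvd _ _).mpr fun q v hq hv => ?_
    rcases Nat.eq_zero_or_pos v with rfl | hv0
    · simp
    refine dvd_finrank_of_forall_restrictsToPadic hq _ fun w e he hw => ?_
    obtain ⟨n, a, hn, hnm, -, hpa⟩ := hw.exists_valuation_root hq (by exact_mod_cast he) hm hv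
      (hunit q hq ((dvd_pow_self q hv0.ne').trans hv)) hroot
    have hdvd : ((q ^ n : ℕ) : ℤ) ∣ ((e * (q ^ n - 1) : ℕ) : ℤ) := by
      refine ⟨(q - 1) * a, ?_⟩
      rw [Nat.cast_mul, Nat.cast_sub (Nat.one_le_pow _ _ hq.pos)]
      push_cast
      exact hpa.symm
    have hcop' : (q ^ n).Coprime (q ^ n - 1) :=
      (Nat.coprime_self_sub_right (Nat.one_le_pow _ _ hq.pos)).mpr (Nat.coprime_one_right _)
    -- `q ^ n` divides `e * (q ^ n - 1)` and is prime to the second factor.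
    exact (pow_dvd_pow q hn).trans (hcop'.dvd_of_dvd_mul_right (Int.natCast_dvd_natCast.mp hdvd))
  · refine dvd_finrank_of_forall_restrictsToPadic hp _ fun w e he hw => ?_
    have he' : (0 : ℤ) < e := by exact_mod_cast he
    -- Only `p ^ 1 ∣ m` is needed here: it gives `n ≥ 1`, hence `a > 0`.
    obtain ⟨n, a, hn, hnm, ha, hpa⟩ := hw.exists_valuation_root hp he' hm
      (by simpa using hpm : p ^ 1 ∣ m) (hunit p hp hpm) hroot
    have hpn : (1 : ℤ) < (p : ℤ) ^ n := by exact_mod_cast Nat.one_lt_pow (by omega) hp.one_lt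
    have hp1 : (1 : ℤ) ≤ p - 1 := by have := hp.two_le; omega
    have ha0 : 0 < a := by
      by_contra h
      have h1 : ((p : ℤ) - 1) * a ≤ 0 := mul_nonpos_of_nonneg_of_nonpos (by omega) (by omega)
      have h2 := mul_nonpos_of_nonneg_of_nonpos (by omega : (0 : ℤ) ≤ (p : ℤ) ^ n) h1
      have h3 : 0 < (e : ℤ) * ((p : ℤ) ^ n - 1) := mul_pos he' (by omega)
      omega
    have hae : a < e := by
      have h1 : a ≤ ((p : ℤ) - 1) * a := le_mul_of_one_le_left ha0.le hp1
      have h2 := mul_le_mul_of_nonneg_left h1 (by omega : (0 : ℤ) ≤ (p : ℤ) ^ n)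
      refine lt_of_mul_lt_mul_left (a := (p : ℤ) ^ n) ?_ (by omega)
      linarith
    obtain ⟨a', -, ha'⟩ := hw.exists_valuation_of_aeval_polyIterate hd0 hlead hf' ha0 hae k ha
    have hdvd : ((f.natDegree ^ k : ℕ) : ℤ) ∣ ((e * (p ^ n - 1) : ℕ) : ℤ) := by
      refine ⟨(p : ℤ) ^ n * ((p - 1) * a'), ?_⟩
      rw [Nat.cast_mul, Nat.cast_sub (Nat.one_le_pow _ _ hp.pos)]
      push_cast
      rw [← hpa, ← ha']
      ring
    exact ((coprime_pow_sub_one hdm hp.one_lt hn hnm).pow_left k).dvd_of_dvd_mul_right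
      (Int.natCast_dvd_natCast.mp hdvd)
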